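/- **Setting.** The Fock space of $m$ bosonic modes has the orthonormal basis $|\mathbf n\rangle=|n_1\dots n_m\rangle$, $\mathbf n\in\mathbb N^m$, with creation and annihilation operators $\hat a_k^\dagger,\hat a_k$. A core state is a nonzero vector $|\psi\rangle=\sum_{\mathbf n}\psi_{\mathbf n}|\mathbf n\rangle$ with finitely many nonzero amplitudes (considered up to normalization). Its stellar polynomial is $P_\psi(\mathbf x)=\sum_{\mathbf n}\frac{\psi_{\mathbf n}}{\sqrt{\mathbf n!}}\,\mathbf x^{\mathbf n}$. The homogenization in degree $d$ of $P=\sum_{\mathbf n} p_{\mathbf n}\mathbf x^{\mathbf n}$ with $\deg P\le d$ is $P^h(y,\mathbf x)=\sum_{\mathbf n}p_{\mathbf n}\,y^{d-|\mathbf n|}\mathbf x^{\mathbf n}$. The Waring rank of a form $F$ of degree $d\ge 1$ is the least $r$ such that $F=\sum_{k=1}^r \ell_k^d$ with complex linear forms $\ell_k$. A multiport interferometer with unitary matrix $U$ is the linear operator $\hat U$ with $\hat U|\mathbf 0\rangle=|\mathbf 0\rangle$ and $\hat U\hat a_j^\dagger\hat U^\dagger=\sum_iU_{ij}\hat a_i^\dagger$.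 The displacement of mode $k$ by $\alpha$ is $\hat D_k(\alpha)=\exp(\alpha\hat a_k^\dagger-\alpha^*\hat a_k)$. **Theorem.** Let $|\psi\rangle$ be a core state with at most $d$ photons in $M$ modes, i.e. $\psi_{\mathbf n}=0$ whenever $|\mathbf n|>d$, and let $r$ be the Waring rank of the homogenization of $P_\psi$ in degree $d$; this rank is finite (if $d=0$, then $r$ plays no role, since $dr=d(r-1)=0$ below). Add two ancillary modes $\lambda$ and $y$. Then there are multiport interferometers $\hat U_1,\dots,\hat U_{dr}$ on the $M+2$ modes and a constant $c\neq 0$ such that $$\langle 0|_y\,\hat D_y(1)\,\langle d(r-1)|_\lambda\;\hat U_{dr}\,\hat a_\lambda^\dagger\cdots\hat U_2\,\hat a_\lambda^\dagger\,\hat U_1\,\hat a_\lambda^\dagger\,|0\rangle^{\otimes(M+2)}=c\,|\psi\rangle .$$ That is, $|\psi\rangle$ is prepared exactly, with nonzero success probability, from the vacuum by $dr$ photon additions alternating with $dr$ multiport interferometers, a projection onto $d(r-1)$ photons in the ancilla $\lambda$, and a displacement by $1$ followed by a projection onto the vacuum in the ancilla $y$. -/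

import Mathlib

/-! Bosonic Fock space of `M` modes, its core states and the optical operations on them.
The Fock basis vector `|n⟩ = |n₁ … n_M⟩` is indexed by `n : Fin M →₀ ℕ`. -/

noncomputable section

namespace Bosonic

open scoped Nat

/-- The Hilbert space of `M` bosonic modes: `ℓ²` over the occupation numbers. -/
abbrev Fock (M : ℕ) : Type := lp (fun _ : Fin M →₀ ℕ => ℂ) 2

/-- Core vectors of `M` modes: the vectors with finite support in the Fock basis, given by their
amplitudes `n ↦ ⟨n|ψ⟩`. This is the invariant dense domain on which the (unbounded) ladder
operators act. -/
abbrev Core (M : ℕ) : Type := (Fin M →₀ ℕ) →₀ ℂ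

/-- The inclusion of core vectors in the Hilbert space, `ψ ↦ ∑ ψ_n |n⟩`. -/
def Core.toFock {M : ℕ} : Core M →ₗ[ℂ] Fock M :=
  Finsupp.linearCombination ℂ fun n => lp.single 2 n (1 : ℂ)

/-- The multimode vacuum `|0 … 0⟩`. -/
def vacuum (M : ℕ) : Core M := Finsupp.single 0 1

/-- Creation operator (photon addition) of mode `k`:
`a†_k |n⟩ = √(n_k + 1) |n + e_k⟩`. -/
def creation {M : ℕ} (k : Fin M) : Module.End ℂ (Core M) :=
  Finsupp.linearCombination ℂ fun n =>
    Finsupp.single (n + Finsupp.single k 1) ((√((n k : ℝ) + 1) : ℝ) : ℂ)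

/-- Annihilation operator of mode `k`: `a_k |n⟩ = √n_k |n - e_k⟩`
(which vanishes if `n_k = 0`). -/
def annihilation {M : ℕ} (k : Fin M) : Module.End ℂ (Core M) :=
  Finsupp.linearCombination ℂ fun n =>
    Finsupp.single (n - Finsupp.single k 1) ((√(n k : ℝ) : ℝ) : ℂ)

/-- The multi-index factorial `n! = n₁! ⋯ n_M!`. -/
def multiFactorial {M : ℕ} (n : Fin M →₀ ℕ) : ℕ := ∏ i, (n i)!

/-- The multiport interferometer (passive linear optics) with mode transformation
`a†_j ↦ ∑ i, U i j a†_i`, which fixes the vacuum: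
`|n⟩ ↦ (n!)^{-1/2} ∏ j, (∑ i, U i j a†_i) ^ n_j |0⟩`. -/
def interferometer {M : ℕ} (U : Matrix.unitaryGroup (Fin M) ℂ) : Module.End ℂ (Core M) :=
  Finsupp.linearCombination ℂ fun n =>
    ((√(multiFactorial n : ℝ) : ℝ) : ℂ)⁻¹ •
      ((List.finRange M).map fun j =>
        (∑ i, (U : Matrix (Fin M) (Fin M) ℂ) i j • creation i) ^ n j).prod (vacuum M)

/-- The vector obtained from the vacuum of `m + 1` modes by `N` rounds, each of which is a photon
addition in mode `0` followed by a multiport interferometer: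
`U_{N-1} a†_0 ⋯ U_1 a†_0 U_0 a†_0 |0⟩`. -/
def additionCircuit {m : ℕ} :
    {N : ℕ} → (Fin N → Matrix.unitaryGroup (Fin (m + 1)) ℂ) → Core (m + 1)
  | 0, _ => vacuum (m + 1)
  | N + 1, U =>
      interferometer (U (Fin.last N)) (creation 0 (additionCircuit fun i : Fin N => U i.castSucc))

theorem cons_injective {m : ℕ} (k : ℕ) :
    Function.Injective (Finsupp.cons k : (Fin m →₀ ℕ) → Fin (m + 1) →₀ ℕ) := fun a b h => by
  rw [← Finsupp.tail_cons k a, h, Finsupp.tail_cons]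

/-- Conditioning a core vector on `k` photons in mode `0`, unnormalized: the core vector `⟨k|₀ ψ` of
the remaining `m` modes. -/
def Core.project {m : ℕ} (k : ℕ) (ψ : Core (m + 1)) : Core m :=
  Finsupp.comapDomain (Finsupp.cons k) ψ (cons_injective k).injOn

theorem memℓp_project {m : ℕ} (k : ℕ) (Φ : Fock (m + 1)) :
    Memℓp (fun n : Fin m →₀ ℕ => Φ (Finsupp.cons k n)) 2 := by
  have h2 : 0 < (2 : ENNReal).toReal := by norm_num
  exact memℓp_gen (((memℓp_gen_iff h2).1 (lp.memℓp Φ)).comp_injective (cons_injective k))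

/-- Conditioning a vector of the Hilbert space on `k` photons in mode `0`, unnormalized: `⟨k|₀ Φ`. -/
def Fock.project {m : ℕ} (k : ℕ) (Φ : Fock (m + 1)) : Fock m :=
  ⟨fun n => Φ (Finsupp.cons k n), memℓp_project k Φ⟩

/-- `Φ = D_k(α) ψ` for the displacement operator `D_k(α) = exp(α a†_k - α* a_k)` of mode `k`: the
exponential series, applied to the core vector `ψ`, converges to `Φ` in the Hilbert space. -/
def IsDisplacement {M : ℕ} (k : Fin M) (α : ℂ) (ψ : Core M) (Φ : Fock M) : Prop :=
  HasSum (fun j : ℕ => ((j ! : ℕ) : ℂ)⁻¹ •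
    Core.toFock (((α • creation k - (starRingEnd ℂ) α • annihilation k) ^ j) ψ)) Φ

/-- The stellar polynomial `∑ n, ψ_n / √n! · x^n` of a core vector. -/
def stellarPolynomial {M : ℕ} (ψ : Core M) : MvPolynomial (Fin M) ℂ :=
  ∑ n ∈ ψ.support, MvPolynomial.monomial n (ψ n / ((√(multiFactorial n : ℝ) : ℝ) : ℂ))

/-- The homogenization in degree `d` of a polynomial `∑ p_n x^n` of degree at most `d`:
`∑ p_n y^(d - |n|) x^n`. The new variable `y` has index `0`. -/
def homogenization {M : ℕ} (d : ℕ) (P : MvPolynomial (Fin M) ℂ) : MvPolynomial (Fin (M + 1)) ℂ :=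
  ∑ n ∈ P.support, MvPolynomial.monomial (Finsupp.cons (d - n.degree) n) (P.coeff n)

/-- `P` is a sum of `r` many `d`-th powers of linear forms. -/
def HasWaringDecomposition {m : ℕ} (d : ℕ) (P : MvPolynomial (Fin m) ℂ) (r : ℕ) : Prop :=
  ∃ w : Fin r → Fin m → ℂ, P = ∑ k, (∑ i, MvPolynomial.C (w k i) * MvPolynomial.X i) ^ d

/-- The Waring rank of a form `P` of degree `d`: the least number of `d`-th powers of linear forms
with sum `P`. -/
def waringRank {m : ℕ} (d : ℕ) (P : MvPolynomial (Fin m) ℂ) : ℕ :=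
  sInf {r | HasWaringDecomposition d P r}

end Bosonic

end

open Bosonic

noncomputable section

namespace Bosonic

open scoped Nat
open Finset (univ)

/-! In the stellar representation every operation becomes algebra on polynomials. A photon addition
multiplies by a variable (`stellar_creation`), an interferometer substitutes variables linearly
(`stellar_interferometer`), and projecting a mode on k photons extracts, up to √k!, the coefficient
of the k-th power of its variable (`stellar_project`). Formally ⟨0|D(1) = e^(-1/2)⟨0|e^(-a), so
displacement followed by the vacuum projection evaluates y at -1, up to e^(-1/2)
(`project_zero_of_isDisplacement`, `stellar_evalMode`).

Hence N rounds prepare any product of N nonzero linear forms up to a scalar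
(`exists_additionCircuit_stellar`). Given a Waring decomposition ∑ ℓ_k^d of the homogenization, the
product ∏ (λ^d + ℓ_k^d) splits over ℂ into dr linear forms, and its coefficient at λ^(d(r-1)) is ∑
ℓ_k^d (`exists_prod_linearForm_coeff_eq_sum_pow`). Dehomogenizing recovers the stellar polynomial,
and `stellar` is injective. The sign of y is flipped in each ℓ_k, since y is evaluated at -1 instead
of 1.

Two further points are finiteness of the Waring rank, by polarization, and norm convergence of the
displacement series on core vectors. -/

/-- The linear form with coefficients `v`. -/
def linearForm {m : ℕ} (v : Fin m → ℂ) : MvPolynomial (Fin m) ℂ :=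
  ∑ i, MvPolynomial.C (v i) * MvPolynomial.X i

theorem linearForm_smul {m : ℕ} (a : ℂ) (v : Fin m → ℂ) :
    linearForm (a • v) = MvPolynomial.C a * linearForm v := by
  simp [linearForm, Finset.mul_sum, mul_assoc]

theorem linearForm_single {m : ℕ} (k : Fin m) :
    linearForm (Pi.single k 1) = MvPolynomial.X k := by
  rw [linearForm, Finset.sum_eq_single k] <;> simp +contextual

/-! ### Waring decompositions of forms -/

/-- Polarization by inclusion-exclusion: each power expands over maps `f : ι → ι` whose image avoids
`T`, and the alternating sum over `T` keeps only surjections. These are permutations, each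
contributing the full product, so `N` is their number. -/
theorem exists_ne_zero_smul_prod_eq_sum_pow {ι R : Type*} [Fintype ι] [DecidableEq ι] [CommRing R]
    (x : ι → R) :
    ∃ N : ℕ, N ≠ 0 ∧ (N : R) * ∏ i, x i =
      ∑ T : Finset ι, (-1) ^ T.card * (∑ i ∈ Tᶜ, x i) ^ Fintype.card ι := by
  refine ⟨(univ.filter fun f : ι → ι => Function.Surjective f).card,
    Finset.card_ne_zero_of_mem (Finset.mem_filter.2 ⟨Finset.mem_univ id, Function.surjective_id⟩), ?_⟩
  have expand (T : Finset ι) : (∑ i ∈ Tᶜ, x i) ^ Fintype.card ι =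
      ∑ f : ι → ι, if T ⊆ (univ.image f)ᶜ then ∏ j, x (f j) else 0 := by
    rw [← Finset.card_univ, ← Finset.prod_const, Finset.prod_univ_sum, ← Finset.sum_filter]
    refine Finset.sum_congr ?_ fun _ _ => rfl
    ext f
    simp only [Fintype.mem_piFinset, Finset.mem_compl, Finset.mem_filter, Finset.mem_univ, true_and,
      Finset.subset_iff, Finset.mem_image, not_exists]
    exact ⟨fun h i hi j hj => h j (hj ▸ hi), fun h j hj => h hj j rfl⟩
  have inner (f : ι → ι) : (∑ T : Finset ι, (-1 : R) ^ T.card *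
      if T ⊆ (univ.image f)ᶜ then ∏ j, x (f j) else 0) =
      if Function.Surjective f then ∏ i, x i else 0 := by
    have h1 : (∑ T : Finset ι, (-1 : R) ^ T.card *
        if T ⊆ (univ.image f)ᶜ then ∏ j, x (f j) else 0) =
        (∑ T ∈ (univ.image f)ᶜ.powerset, (-1 : R) ^ T.card) * ∏ j, x (f j) := by
      simp only [mul_ite, mul_zero]
      rw [← Finset.sum_filter, Finset.sum_mul]
      exact Finset.sum_congr (by ext; simp) fun _ _ => rfl
    have h2 := congrArg (Int.cast : ℤ → R)
      (Finset.sum_powerset_neg_one_pow_card (x := (univ.image f)ᶜ))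
    push_cast at h2
    rw [h1, h2]
    have h3 : (univ.image f)ᶜ = ∅ ↔ Function.Surjective f := by
      simp [Finset.compl_eq_empty_iff, Finset.eq_univ_iff_forall, Function.Surjective]
    by_cases hf : Function.Surjective f
    · rw [if_pos hf, if_pos (h3.2 hf), one_mul]
      exact (Equiv.ofBijective f (Finite.surjective_iff_bijective.1 hf)).prod_comp x
    · rw [if_neg hf, if_neg (mt h3.1 hf), zero_mul]
  simp only [expand, Finset.mul_sum]
  rw [Finset.sum_comm, Finset.sum_congr rfl fun f _ => inner f, ← Finset.sum_filter,
    Finset.sum_const, nsmul_eq_mul]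

theorem HasWaringDecomposition.zero {m : ℕ} (d : ℕ) :
    HasWaringDecomposition d (0 : MvPolynomial (Fin m) ℂ) 0 :=
  ⟨Fin.elim0, by simp⟩

theorem HasWaringDecomposition.add {m d r s : ℕ} {P Q : MvPolynomial (Fin m) ℂ}
    (hP : HasWaringDecomposition d P r) (hQ : HasWaringDecomposition d Q s) :
    HasWaringDecomposition d (P + Q) (r + s) := by
  obtain ⟨v, rfl⟩ := hP
  obtain ⟨w, rfl⟩ := hQ
  exact ⟨Fin.append v w, by simp [Fin.sum_univ_add]⟩

theorem hasWaringDecomposition_C_mul_pow {m d : ℕ} (hd : 0 < d) (a : ℂ) (v : Fin m → ℂ) :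
    HasWaringDecomposition d (MvPolynomial.C a * linearForm v ^ d) 1 := by
  obtain ⟨b, rfl⟩ := IsAlgClosed.exists_pow_nat_eq a hd
  refine ⟨fun _ => b • v, ?_⟩
  rw [Fin.sum_univ_one]
  change _ = linearForm (b • v) ^ d
  rw [linearForm_smul, mul_pow, map_pow]

theorem exists_hasWaringDecomposition_sum {ι : Type*} {m d : ℕ} (s : Finset ι)
    (P : ι → MvPolynomial (Fin m) ℂ) (h : ∀ i ∈ s, ∃ r, HasWaringDecomposition d (P i) r) :
    ∃ r, HasWaringDecomposition d (∑ i ∈ s, P i) r := by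
  refine Finset.sum_induction P (fun Q => ∃ r, HasWaringDecomposition d Q r) ?_ ⟨0, .zero d⟩ h
  rintro P Q ⟨r, hP⟩ ⟨s, hQ⟩
  exact ⟨r + s, hP.add hQ⟩

theorem exists_prod_X_eq_monomial {m : ℕ} (d : ℕ) : ∀ n : Fin m →₀ ℕ, n.degree = d →
    ∃ g : Fin d → Fin m, ∏ j, (MvPolynomial.X (g j) : MvPolynomial (Fin m) ℂ) =
      MvPolynomial.monomial n 1 := by
  induction d with
  | zero =>
    intro n hn
    rw [Finsupp.degree_eq_zero_iff] at hn
    exact ⟨Fin.elim0, by simp [hn]⟩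
  | succ d ih =>
    intro n hn
    obtain ⟨i, hi⟩ : ∃ i, n i ≠ 0 := by
      by_contra! h
      rw [show n = 0 from Finsupp.ext h] at hn
      simp at hn
    have hle : Finsupp.single i 1 ≤ n := by
      rw [Finsupp.single_le_iff]; omega
    have hn' : n - Finsupp.single i 1 + Finsupp.single i 1 = n := tsub_add_cancel_of_le hle
    obtain ⟨g, hg⟩ := ih (n - Finsupp.single i 1) (by
      have h := congrArg Finsupp.degree hn'
      rw [map_add, Finsupp.degree_single, hn] at h
      omega)
    refine ⟨Fin.cons i g, ?_⟩
    rw [Fin.prod_univ_succ]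
    simp only [Fin.cons_zero, Fin.cons_succ, hg]
    rw [MvPolynomial.X, MvPolynomial.monomial_mul, one_mul, add_comm, hn']

theorem exists_hasWaringDecomposition_monomial {m d : ℕ} (hd : 0 < d) (n : Fin m →₀ ℕ)
    (hn : n.degree = d) (a : ℂ) :
    ∃ r, HasWaringDecomposition d (MvPolynomial.monomial n a) r := by
  obtain ⟨g, hg⟩ := exists_prod_X_eq_monomial d n hn
  obtain ⟨N, hN, h⟩ := exists_ne_zero_smul_prod_eq_sum_pow
    fun j => (MvPolynomial.X (g j) : MvPolynomial (Fin m) ℂ)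
  have key : MvPolynomial.monomial n a = ∑ T : Finset (Fin d),
      MvPolynomial.C (a / N * (-1) ^ T.card) *
        linearForm (∑ j ∈ Tᶜ, Pi.single (g j) (1 : ℂ)) ^ d := by
    have hlin (T : Finset (Fin d)) : linearForm (∑ j ∈ Tᶜ, Pi.single (g j) (1 : ℂ)) =
        ∑ j ∈ Tᶜ, MvPolynomial.X (g j) := by
      simp only [← linearForm_single]
      simp only [linearForm, Finset.sum_apply, map_sum, Finset.sum_mul]
      rw [Finset.sum_comm]
    rw [hg, Fintype.card_fin] at h
    have hN' : (N : ℂ) ≠ 0 := Nat.cast_ne_zero.2 hN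
    calc MvPolynomial.monomial n a
        = MvPolynomial.C (a / N) * ((N : MvPolynomial (Fin m) ℂ) * MvPolynomial.monomial n 1) := by
          rw [← mul_assoc, ← map_natCast MvPolynomial.C, ← map_mul, div_mul_cancel₀ _ hN',
            MvPolynomial.C_mul_monomial, mul_one]
      _ = _ := by
          rw [h, Finset.mul_sum]
          refine Finset.sum_congr rfl fun T _ => ?_
          rw [hlin, map_mul, map_pow, map_neg, map_one, mul_assoc]
  rw [key]
  exact exists_hasWaringDecomposition_sum _ _ fun T _ =>
    ⟨1, hasWaringDecomposition_C_mul_pow hd _ _⟩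

theorem exists_hasWaringDecomposition_homogenization {M d : ℕ} (hd : 0 < d)
    (P : MvPolynomial (Fin M) ℂ) (hP : ∀ n ∈ P.support, n.degree ≤ d) :
    ∃ r, HasWaringDecomposition d (homogenization d P) r :=
  exists_hasWaringDecomposition_sum _ _ fun n hn =>
    exists_hasWaringDecomposition_monomial hd _ (by
      -- The bound makes the truncated `d - n.degree` an exact difference, so each monomial has
      -- degree `d`.
      have h := hP n hn
      have h2 : (Finsupp.cons (d - n.degree) n).degree = d - n.degree + n.degree := by
        simp [Finsupp.degree_eq_sum, Fin.sum_univ_succ]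
      omega) _

/-! ### The stellar representation -/

/-- The stellar polynomial, as a linear map. -/
def stellar {M : ℕ} : Core M →ₗ[ℂ] MvPolynomial (Fin M) ℂ :=
  Finsupp.linearCombination ℂ fun n => MvPolynomial.monomial n ((√(multiFactorial n : ℝ) : ℝ) : ℂ)⁻¹

theorem multiFactorial_pos {M : ℕ} (n : Fin M →₀ ℕ) : 0 < multiFactorial n :=
  Finset.prod_pos fun _ _ => Nat.factorial_pos _

theorem sqrt_multiFactorial_ne_zero {M : ℕ} (n : Fin M →₀ ℕ) :
    ((√(multiFactorial n : ℝ) : ℝ) : ℂ) ≠ 0 :=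
  Complex.ofReal_ne_zero.2 (Real.sqrt_pos.2 (Nat.cast_pos.2 (multiFactorial_pos n))).ne'

theorem stellar_single {M : ℕ} (n : Fin M →₀ ℕ) (a : ℂ) :
    stellar (Finsupp.single n a) =
      MvPolynomial.monomial n (a / ((√(multiFactorial n : ℝ) : ℝ) : ℂ)) := by
  rw [stellar, Finsupp.linearCombination_single, MvPolynomial.smul_monomial, smul_eq_mul,
    div_eq_mul_inv]

theorem stellarPolynomial_eq_stellar {M : ℕ} (ψ : Core M) : stellarPolynomial ψ = stellar ψ := by
  conv_rhs => rw [← Finsupp.sum_single ψ, Finsupp.sum, map_sum]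
  simp only [stellar_single, stellarPolynomial]

theorem coeff_stellar {M : ℕ} (ψ : Core M) (n : Fin M →₀ ℕ) :
    (stellar ψ).coeff n = ψ n / ((√(multiFactorial n : ℝ) : ℝ) : ℂ) := by
  induction ψ using Finsupp.induction_linear with
  | zero => simp
  | add f g hf hg => rw [map_add, MvPolynomial.coeff_add, hf, hg, Finsupp.add_apply, add_div]
  | single k a =>
    rw [stellar_single, MvPolynomial.coeff_monomial, Finsupp.single_apply]
    split_ifs with h
    · rw [h]
    · rw [zero_div]

theorem stellar_injective {M : ℕ} : Function.Injective (stellar (M := M)) := fun χ ψ h => by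
  ext n
  have h1 := congrArg (MvPolynomial.coeff n) h
  rwa [coeff_stellar, coeff_stellar, div_left_inj' (sqrt_multiFactorial_ne_zero n)] at h1

theorem stellar_vacuum (M : ℕ) : stellar (vacuum M) = 1 := by
  simp [vacuum, stellar_single, multiFactorial]

theorem multiFactorial_add_single {M : ℕ} (n : Fin M →₀ ℕ) (k : Fin M) :
    multiFactorial (n + Finsupp.single k 1) = (n k + 1) * multiFactorial n := by
  rw [multiFactorial, multiFactorial, ← Finset.mul_prod_erase _ _ (Finset.mem_univ k),
    ← Finset.mul_prod_erase univ (fun i => (n i)!) (Finset.mem_univ k), ← mul_assoc]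
  congr 1
  · simp [Nat.factorial_succ]
  · refine Finset.prod_congr rfl fun i hi => ?_
    rw [Finsupp.add_apply, Finsupp.single_eq_of_ne (Finset.ne_of_mem_erase hi), add_zero]

/-- The factor √(n_k + 1) of the creation operator cancels against the growth of √n! in the
normalization. -/
theorem stellar_creation {M : ℕ} (k : Fin M) (ψ : Core M) :
    stellar (creation k ψ) = MvPolynomial.X k * stellar ψ := by
  induction ψ using Finsupp.induction_linear with
  | zero => simp
  | add f g hf hg => rw [map_add, map_add, hf, hg, map_add, mul_add]
  | single n a =>
    rw [creation, Finsupp.linearCombination_single, Finsupp.smul_single, stellar_single,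
      stellar_single, MvPolynomial.X, MvPolynomial.monomial_mul, add_comm (Finsupp.single k 1), one_mul,
      multiFactorial_add_single]
    congr 1
    have h : (√((n k : ℝ) + 1) : ℂ) ≠ 0 :=
      Complex.ofReal_ne_zero.2 (Real.sqrt_pos.2 (by positivity)).ne'
    have h' := sqrt_multiFactorial_ne_zero n
    push_cast
    rw [Real.sqrt_mul (by positivity)]
    push_cast
    rw [smul_eq_mul]
    field_simp

/-- The substitution `x_j ↦ ∑ i, U i j x_i`. -/
def substitution {M : ℕ} (U : Matrix (Fin M) (Fin M) ℂ) :
    MvPolynomial (Fin M) ℂ →ₐ[ℂ] MvPolynomial (Fin M) ℂ :=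
  MvPolynomial.aeval fun j => linearForm fun i => U i j

theorem stellar_interferometer {M : ℕ} (U : Matrix.unitaryGroup (Fin M) ℂ) (ψ : Core M) :
    stellar (interferometer U ψ) = substitution U (stellar ψ) := by
  have hsum (j : Fin M) (χ : Core M) :
      stellar ((∑ i, (U : Matrix (Fin M) (Fin M) ℂ) i j • creation i) χ) =
        linearForm (fun i => (U : Matrix (Fin M) (Fin M) ℂ) i j) * stellar χ := by
    simp [LinearMap.sum_apply, stellar_creation, linearForm, Finset.sum_mul,
      MvPolynomial.smul_eq_C_mul, mul_assoc]
  have hpow (j : Fin M) (e : ℕ) (χ : Core M) :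
      stellar (((∑ i, (U : Matrix (Fin M) (Fin M) ℂ) i j • creation i) ^ e) χ) =
        linearForm (fun i => (U : Matrix (Fin M) (Fin M) ℂ) i j) ^ e * stellar χ := by
    induction e with
    | zero => simp
    | succ e ih => rw [pow_succ', Module.End.mul_apply, hsum, ih, pow_succ', mul_assoc]
  have hlist (n : Fin M →₀ ℕ) (l : List (Fin M)) (χ : Core M) :
      stellar ((l.map fun j =>
        (∑ i, (U : Matrix (Fin M) (Fin M) ℂ) i j • creation i) ^ n j).prod χ) =
        (l.map fun j => linearForm (fun i => (U : Matrix (Fin M) (Fin M) ℂ) i j) ^ n j).prod *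
          stellar χ := by
    induction l with
    | nil => simp
    | cons j l ih =>
      rw [List.map_cons, List.prod_cons, Module.End.mul_apply, hpow, ih, List.map_cons,
        List.prod_cons, mul_assoc]
  induction ψ using Finsupp.induction_linear with
  | zero => simp
  | add f g hf hg => rw [map_add, map_add, hf, hg, map_add, map_add]
  | single n a =>
    rw [interferometer, Finsupp.linearCombination_single, map_smul, map_smul, hlist, stellar_vacuum,
      mul_one, stellar_single, substitution, MvPolynomial.aeval_monomial, Finsupp.prod_fintype _ _
      (fun i => pow_zero _), Fin.prod_univ_def, smul_smul, Algebra.smul_def, div_eq_mul_inv]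

theorem substitution_linearForm {M : ℕ} (U : Matrix (Fin M) (Fin M) ℂ) (v : Fin M → ℂ) :
    substitution U (linearForm v) = linearForm (U.mulVec v) := by
  simp only [substitution, linearForm, map_sum, map_mul, MvPolynomial.aeval_X, Finset.mul_sum,
    Matrix.mulVec, dotProduct, Finset.sum_mul]
  rw [Finset.sum_comm]
  refine Finset.sum_congr rfl fun i _ => Finset.sum_congr rfl fun j _ => ?_
  rw [← MvPolynomial.algebraMap_eq, AlgHom.commutes]
  ring

/-! ### States prepared by photon additions and interferometers -/

/-- Normalize `v` and extend it to an orthonormal basis; the basis vectors are the columns of `V`.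
-/
theorem exists_unitary_col {m : ℕ} (v : Fin (m + 1) → ℂ) (hv : v ≠ 0) :
    ∃ (V : Matrix.unitaryGroup (Fin (m + 1)) ℂ) (c : ℂ), c ≠ 0 ∧
      (V : Matrix (Fin (m + 1)) (Fin (m + 1)) ℂ).mulVec (Pi.single 0 1) = c • v := by
  set x : EuclideanSpace ℂ (Fin (m + 1)) := WithLp.toLp 2 v with hx
  have hx0 : x ≠ 0 := fun h => hv (by simpa [hx] using h)
  have hn : (‖x‖ : ℂ) ≠ 0 := by simpa using hx0
  obtain ⟨b, hb⟩ := Orthonormal.exists_orthonormalBasis_extension_of_card_eq (𝕜 := ℂ)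
    (E := EuclideanSpace ℂ (Fin (m + 1))) (ι := Fin (m + 1)) (by simp)
    (v := fun _ => (‖x‖ : ℂ)⁻¹ • x) (s := {0}) (by
      refine ⟨fun i => ?_, fun i j hij => (hij (Subsingleton.elim i j)).elim⟩
      simp [norm_smul, hx0])
  refine ⟨⟨_, (EuclideanSpace.basisFun (Fin (m + 1)) ℂ).toMatrix_orthonormalBasis_mem_unitary b⟩,
    (‖x‖ : ℂ)⁻¹, inv_ne_zero hn, ?_⟩
  ext i
  rw [Matrix.mulVec_single_one]
  simp [Module.Basis.toMatrix_apply, hb 0 rfl, hx]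

/-- The last unitary `V` turns the newly added variable into the last form, but also transforms all
earlier factors. The induction hypothesis is therefore applied to the earlier forms pulled back by
`V⁻¹`. -/
theorem exists_additionCircuit_stellar {m : ℕ} : ∀ {N : ℕ} (v : Fin N → Fin (m + 1) → ℂ),
    (∀ s, v s ≠ 0) → ∃ (U : Fin N → Matrix.unitaryGroup (Fin (m + 1)) ℂ) (c : ℂ), c ≠ 0 ∧
      stellar (additionCircuit U) = c • ∏ s, linearForm (v s) := by
  intro N
  induction N with
  | zero => exact fun v _ => ⟨Fin.elim0, 1, one_ne_zero, by simp [additionCircuit, stellar_vacuum]⟩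
  | succ N ih =>
    intro v hv
    obtain ⟨V, a, ha, hV⟩ := exists_unitary_col (v (Fin.last N)) (hv _)
    have hVV (w : Fin (m + 1) → ℂ) : (V : Matrix (Fin (m + 1)) (Fin (m + 1)) ℂ).mulVec
        (((V⁻¹ : Matrix.unitaryGroup (Fin (m + 1)) ℂ) :
          Matrix (Fin (m + 1)) (Fin (m + 1)) ℂ).mulVec w) = w := by
      rw [Matrix.mulVec_mulVec, ← Submonoid.coe_mul, mul_inv_cancel, Submonoid.coe_one,
        Matrix.one_mulVec]
    obtain ⟨U, c, hc, hU⟩ := ih (fun s => ((V⁻¹ : Matrix.unitaryGroup (Fin (m + 1)) ℂ) :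
      Matrix (Fin (m + 1)) (Fin (m + 1)) ℂ).mulVec (v s.castSucc)) fun s h => hv s.castSucc (by
        rw [← hVV (v s.castSucc), h, Matrix.mulVec_zero])
    refine ⟨Fin.snoc (α := fun _ => Matrix.unitaryGroup (Fin (m + 1)) ℂ) U V, c * a,
      mul_ne_zero hc ha, ?_⟩
    simp only [additionCircuit, Fin.snoc_last, Fin.snoc_castSucc]
    rw [stellar_interferometer, stellar_creation, hU, map_mul, map_smul, map_prod]
    simp only [substitution_linearForm, hVV]
    rw [← linearForm_single, substitution_linearForm, hV, linearForm_smul, Fin.prod_univ_castSucc,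
      MvPolynomial.smul_eq_C_mul, MvPolynomial.smul_eq_C_mul, map_mul]
    ring

/-! ### Displacement of a mode, conditioned on the vacuum -/

theorem creation_single {M : ℕ} (k : Fin M) (n : Fin M →₀ ℕ) (a : ℂ) :
    creation k (Finsupp.single n a) =
      Finsupp.single (n + Finsupp.single k 1) (a * ((√((n k : ℝ) + 1) : ℝ) : ℂ)) := by
  rw [creation, Finsupp.linearCombination_single, Finsupp.smul_single, smul_eq_mul]

theorem annihilation_single {M : ℕ} (k : Fin M) (n : Fin M →₀ ℕ) (a : ℂ) :
    annihilation k (Finsupp.single n a) =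
      Finsupp.single (n - Finsupp.single k 1) (a * ((√(n k : ℝ) : ℝ) : ℂ)) := by
  rw [annihilation, Finsupp.linearCombination_single, Finsupp.smul_single, smul_eq_mul]

theorem annihilation_mul_creation {M : ℕ} (k : Fin M) :
    annihilation k * creation k = creation k * annihilation k + 1 := by
  refine Finsupp.lhom_ext fun n a => ?_
  rw [LinearMap.add_apply, Module.End.mul_apply, Module.End.mul_apply, Module.End.one_apply,
    creation_single, annihilation_single, annihilation_single, creation_single,
    add_tsub_cancel_right]
  have sq (x : ℝ) (hx : 0 ≤ x) : ((√x : ℝ) : ℂ) * ((√x : ℝ) : ℂ) = (x : ℂ) := by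
    rw [← Complex.ofReal_mul, Real.mul_self_sqrt hx]
  rcases Nat.eq_zero_or_pos (n k) with h | h
  · simp [h]
  · have hn : n - Finsupp.single k 1 + Finsupp.single k 1 = n :=
      tsub_add_cancel_of_le (Finsupp.single_le_iff.2 h)
    have hk : (((n - Finsupp.single k 1 : Fin M →₀ ℕ) k : ℕ) : ℝ) + 1 = n k := by
      rw [Finsupp.tsub_apply, Finsupp.single_eq_same, Nat.cast_sub h]
      simp
    have hk' : (((n + Finsupp.single k 1 : Fin M →₀ ℕ) k : ℕ) : ℝ) = n k + 1 := by simp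
    rw [hn, hk, hk', ← Finsupp.single_add, mul_assoc, mul_assoc, sq _ (by positivity),
      sq _ (by positivity)]
    push_cast
    congr 1
    ring

/-- The generator `a†_k - a_k` of the displacement of mode `k` by `1`. -/
def generator {M : ℕ} (k : Fin M) : Module.End ℂ (Core M) := creation k - annihilation k

/-- The commutator of a† with a† - a is 1, so commuting with a† differentiates powers of the
generator. -/
theorem creation_mul_generator_pow {M : ℕ} (k : Fin M) (j : ℕ) :
    creation k * generator k ^ (j + 1) =
      generator k ^ (j + 1) * creation k + ((j : ℂ) + 1) • generator k ^ j := by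
  have h1 : creation k * generator k = generator k * creation k + 1 := by
    refine LinearMap.ext fun ψ => ?_
    have h := LinearMap.congr_fun (annihilation_mul_creation k) ψ
    simp only [Module.End.mul_apply, LinearMap.add_apply, Module.End.one_apply] at h
    simp only [generator, Module.End.mul_apply, LinearMap.sub_apply, LinearMap.add_apply,
      Module.End.one_apply, map_sub, h]
    abel
  induction j with
  | zero => simp [h1]
  | succ j ih =>
    rw [pow_succ, ← mul_assoc, ih, add_mul, mul_assoc, h1, mul_add, mul_one, smul_mul_assoc,
      ← pow_succ, ← mul_assoc, ← pow_succ, add_assoc]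
    congr 1
    push_cast
    module

theorem creation_apply_cons_zero {M : ℕ} (ψ : Core (M + 1)) (n : Fin M →₀ ℕ) :
    creation 0 ψ (Finsupp.cons 0 n) = 0 := by
  induction ψ using Finsupp.induction_linear with
  | zero => simp
  | add f g hf hg => rw [map_add, Finsupp.add_apply, hf, hg, add_zero]
  | single k a =>
    rw [creation_single, Finsupp.single_apply, if_neg]
    intro h
    simpa using DFunLike.congr_fun h 0

/-- The amplitude of the `j`-th term of the exponential series of the displacement, conditioned on
no photon in mode `0`. -/
def seriesTerm {M : ℕ} (n : Fin M →₀ ℕ) (ψ : Core (M + 1)) (j : ℕ) : ℂ :=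
  ((j ! : ℕ) : ℂ)⁻¹ * (generator 0 ^ j) ψ (Finsupp.cons 0 n)

theorem seriesTerm_zero_creation {M : ℕ} (n : Fin M →₀ ℕ) (ψ : Core (M + 1)) :
    seriesTerm n (creation 0 ψ) 0 = 0 := by
  simp [seriesTerm, creation_apply_cons_zero]

/-- Since ⟨0|a† = 0, the commutation relation leaves only its derivative term, and (j + 1)/(j + 1)!
= 1/j!. -/
theorem seriesTerm_succ_creation {M : ℕ} (n : Fin M →₀ ℕ) (ψ : Core (M + 1)) (j : ℕ) :
    seriesTerm n (creation 0 ψ) (j + 1) = -seriesTerm n ψ j := by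
  have h := DFunLike.congr_fun (LinearMap.congr_fun (creation_mul_generator_pow (0 : Fin (M + 1)) j)
    ψ) (Finsupp.cons 0 n)
  rw [LinearMap.add_apply, Module.End.mul_apply, Module.End.mul_apply, LinearMap.smul_apply,
    creation_apply_cons_zero, Finsupp.add_apply, Finsupp.smul_apply, smul_eq_mul] at h
  rw [seriesTerm, seriesTerm, eq_neg_of_add_eq_zero_left h.symm, Nat.factorial_succ]
  have h1 : ((j : ℂ) + 1) ≠ 0 := Nat.cast_add_one_ne_zero j
  have h2 : ((j ! : ℕ) : ℂ) ≠ 0 := Nat.cast_ne_zero.2 (Nat.factorial_ne_zero j)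
  push_cast
  field_simp

/-- On a vector killed by a, the first application of the generator is a creation, so the previous
shift applies. -/
theorem seriesTerm_add_two_of_annihilation {M : ℕ} (n : Fin M →₀ ℕ) (ψ : Core (M + 1))
    (hψ : annihilation 0 ψ = 0) (j : ℕ) :
    seriesTerm n ψ (j + 2) = -seriesTerm n ψ j / ((j : ℂ) + 2) := by
  have h : seriesTerm n ψ (j + 2) = seriesTerm n (creation 0 ψ) (j + 1) / ((j : ℂ) + 2) := by
    rw [seriesTerm, seriesTerm, pow_succ, Module.End.mul_apply, generator, LinearMap.sub_apply, hψ,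
      sub_zero, Nat.factorial_succ (j + 1)]
    have h1 : ((j : ℂ) + 2) ≠ 0 := by exact_mod_cast (by omega : j + 2 ≠ 0)
    push_cast
    rw [show ((j : ℂ) + 1 + 1) = (j : ℂ) + 2 by ring, mul_inv]
    ring
  rw [h, seriesTerm_succ_creation]

/-- The two-step recursion makes the odd terms vanish and the even ones the exponential series at
-1/2. -/
theorem hasSum_seriesTerm_of_annihilation {M : ℕ} (n : Fin M →₀ ℕ) (ψ : Core (M + 1))
    (hψ : annihilation 0 ψ = 0) :
    HasSum (seriesTerm n ψ) (Complex.exp (-1 / 2) * ψ (Finsupp.cons 0 n)) := by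
  have h0 : seriesTerm n ψ 0 = ψ (Finsupp.cons 0 n) := by simp [seriesTerm]
  have h1 : seriesTerm n ψ 1 = 0 := by
    simp [seriesTerm, generator, hψ, creation_apply_cons_zero]
  have heven (i : ℕ) : seriesTerm n ψ (2 * i) =
      (-1 / 2) ^ i / ((i ! : ℕ) : ℂ) * ψ (Finsupp.cons 0 n) := by
    induction i with
    | zero => simp [h0]
    | succ i ih =>
      rw [show 2 * (i + 1) = 2 * i + 2 by ring, seriesTerm_add_two_of_annihilation n ψ hψ, ih,
        Nat.factorial_succ, pow_succ]
      have h1 : ((i : ℂ) + 1) ≠ 0 := Nat.cast_add_one_ne_zero i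
      have h2 : ((i ! : ℕ) : ℂ) ≠ 0 := Nat.cast_ne_zero.2 (Nat.factorial_ne_zero i)
      push_cast
      rw [show (2 * (i : ℂ) + 2) = 2 * (i + 1) by ring]
      field_simp
  have hodd (i : ℕ) : seriesTerm n ψ (2 * i + 1) = 0 := by
    induction i with
    | zero => simp [h1]
    | succ i ih =>
      rw [show 2 * (i + 1) + 1 = 2 * i + 1 + 2 by ring,
        seriesTerm_add_two_of_annihilation n ψ hψ, ih, neg_zero, zero_div]
  rw [← add_zero (Complex.exp (-1 / 2) * _)]
  refine HasSum.even_add_odd ?_ ?_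
  · simp only [heven]
    refine HasSum.mul_right _ ?_
    rw [Complex.exp_eq_exp_ℂ]
    exact NormedSpace.expSeries_div_hasSum_exp (-1 / 2 : ℂ)
  · simp only [hodd]
    exact hasSum_zero

/-- The map `|k, n⟩ ↦ (-1)^k / √k! |n⟩`, which acts on stellar polynomials as the evaluation of the
first variable at `-1`. -/
def evalMode {M : ℕ} : Core (M + 1) →ₗ[ℂ] Core M :=
  Finsupp.linearCombination ℂ fun k =>
    Finsupp.single k.tail ((-1) ^ k 0 / ((√((k 0)! : ℝ) : ℝ) : ℂ))

theorem evalMode_single {M : ℕ} (k : Fin (M + 1) →₀ ℕ) (a : ℂ) :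
    evalMode (Finsupp.single k a) =
      Finsupp.single k.tail (a * ((-1) ^ k 0 / ((√((k 0)! : ℝ) : ℝ) : ℂ))) := by
  rw [evalMode, Finsupp.linearCombination_single, Finsupp.smul_single, smul_eq_mul]

theorem tail_add_single_zero {M : ℕ} (k : Fin (M + 1) →₀ ℕ) (e : ℕ) :
    (k + Finsupp.single 0 e).tail = k.tail := by
  ext i
  simp [Finsupp.tail_apply]

theorem evalMode_creation {M : ℕ} (ψ : Core (M + 1)) :
    evalMode (creation 0 ψ) = -evalMode ψ := by
  induction ψ using Finsupp.induction_linear with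
  | zero => simp
  | add f g hf hg => rw [map_add, map_add, hf, hg, map_add, neg_add]
  | single k a =>
    rw [creation_single, evalMode_single, evalMode_single, tail_add_single_zero,
      ← Finsupp.single_neg]
    congr 1
    have h : ((√((k 0 : ℝ) + 1) : ℝ) : ℂ) ≠ 0 :=
      Complex.ofReal_ne_zero.2 (Real.sqrt_pos.2 (by positivity)).ne'
    have h' : ((√((k 0)! : ℝ) : ℝ) : ℂ) ≠ 0 :=
      Complex.ofReal_ne_zero.2 (Real.sqrt_pos.2 (by positivity)).ne'
    rw [Finsupp.add_apply, Finsupp.single_eq_same, Nat.factorial_succ]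
    push_cast
    rw [Real.sqrt_mul (by positivity)]
    push_cast
    rw [pow_succ]
    field_simp

theorem hasSum_seriesTerm {M : ℕ} (n : Fin M →₀ ℕ) (ψ : Core (M + 1)) :
    HasSum (seriesTerm n ψ) (Complex.exp (-1 / 2) * evalMode ψ n) := by
  have hcreation (ψ : Core (M + 1))
      (h : HasSum (seriesTerm n ψ) (Complex.exp (-1 / 2) * evalMode ψ n)) :
      HasSum (seriesTerm n (creation 0 ψ)) (Complex.exp (-1 / 2) * evalMode (creation 0 ψ) n) := by
    -- The zeroth term vanishes; without it, the series is the negative of the one for `ψ`.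
    rw [evalMode_creation, Finsupp.neg_apply, mul_neg, ← hasSum_nat_add_iff' 1]
    simpa [seriesTerm_zero_creation, seriesTerm_succ_creation] using h.neg
  have hbasis (e : ℕ) : ∀ (k : Fin (M + 1) →₀ ℕ) (a : ℂ), k 0 = e →
      HasSum (seriesTerm n (Finsupp.single k a))
        (Complex.exp (-1 / 2) * evalMode (Finsupp.single k a) n) := by
    induction e with
    | zero =>
      intro k a hk
      have h := hasSum_seriesTerm_of_annihilation n (Finsupp.single k a)
        (by simp [annihilation_single, hk])
      have hk' : k = Finsupp.cons 0 k.tail := by rw [← hk, Finsupp.cons_tail]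
      convert h using 2
      rw [evalMode_single, hk', Finsupp.single_apply, Finsupp.single_apply, Finsupp.tail_cons]
      simp [(cons_injective (m := M) 0).eq_iff]
    | succ e ih =>
      intro k a hk
      have hk' : k - Finsupp.single 0 1 + Finsupp.single 0 1 = k :=
        tsub_add_cancel_of_le (Finsupp.single_le_iff.2 (by omega))
      have he : (k - Finsupp.single 0 1 : Fin (M + 1) →₀ ℕ) 0 = e := by simp [hk]
      -- The amplitude is divided by √(e + 1) so that the creation operator restores exactly `a`.
      have h := hcreation _ (ih (k - Finsupp.single 0 1) (a / ((√((e : ℝ) + 1) : ℝ) : ℂ)) he)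
      rwa [creation_single, hk', he, div_mul_cancel₀] at h
      exact Complex.ofReal_ne_zero.2 (Real.sqrt_pos.2 (by positivity)).ne'
  induction ψ using Finsupp.induction_linear with
  | zero =>
    have h : seriesTerm n (0 : Core (M + 1)) = fun _ => 0 := by ext; simp [seriesTerm]
    simp [h]
  | add f g hf hg =>
    have h : seriesTerm n (f + g) = fun j => seriesTerm n f j + seriesTerm n g j := by
      ext; simp [seriesTerm, mul_add]
    rw [h, map_add, Finsupp.add_apply, mul_add]
    exact hf.add hg
  | single k a => exact hbasis _ k a rfl

theorem toFock_apply {M : ℕ} (ψ : Core M) (n : Fin M →₀ ℕ) : Core.toFock ψ n = ψ n := by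
  induction ψ using Finsupp.induction_linear with
  | zero => simp
  | add f g hf hg => rw [map_add, lp.coeFn_add, Pi.add_apply, hf, hg, Finsupp.add_apply]
  | single k a =>
    rw [Core.toFock, Finsupp.linearCombination_single, lp.coeFn_smul, Pi.smul_apply,
      lp.single_apply, Pi.single_apply, Finsupp.single_apply]
    by_cases h : k = n
    · simp [h]
    · simp [h, Ne.symm h]

theorem norm_toFock_single {M : ℕ} (n : Fin M →₀ ℕ) (a : ℂ) :
    ‖Core.toFock (Finsupp.single n a)‖ = ‖a‖ := by
  rw [Core.toFock, Finsupp.linearCombination_single, norm_smul, lp.norm_single (by norm_num),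
    norm_one, mul_one]

/-- Each generator yields two basis vectors with weights at most √(D + 1). Using a bound `D` instead
of the exact occupation lets both branches continue with `D + 1`. -/
theorem norm_toFock_generator_pow_single_le {M : ℕ} (k : Fin M) (j : ℕ) :
    ∀ (n : Fin M →₀ ℕ) (a : ℂ) (D : ℕ), n k ≤ D →
      ‖Core.toFock ((generator k ^ j) (Finsupp.single n a))‖ ≤
        ‖a‖ * (2 ^ j * √((D + 1).ascFactorial j : ℝ)) := by
  induction j with
  | zero => intro n a D _; simp [norm_toFock_single]
  | succ j ih =>
    intro n a D hD
    have hD' : (n k : ℝ) ≤ D := Nat.cast_le.2 hD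
    have hs : √(((D + 1).ascFactorial (j + 1) : ℕ) : ℝ) =
        √((D : ℝ) + 1) * √(((D + 1 + 1).ascFactorial j : ℕ) : ℝ) := by
      rw [← Real.sqrt_mul (by positivity), Nat.ascFactorial_succ, ← Nat.succ_ascFactorial]
      push_cast
      rfl
    have h1 := ih (n + Finsupp.single k 1) (a * ((√((n k : ℝ) + 1) : ℝ) : ℂ)) (D + 1) (by simpa)
    have h2 := ih (n - Finsupp.single k 1) (a * ((√(n k : ℝ) : ℝ) : ℂ)) (D + 1) (by simp; omega)
    rw [norm_mul, Complex.norm_real, Real.norm_of_nonneg (Real.sqrt_nonneg _)] at h1 h2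
    have h3 : √((n k : ℝ) + 1) ≤ √((D : ℝ) + 1) := Real.sqrt_le_sqrt (by linarith)
    have h4 : √(n k : ℝ) ≤ √((D : ℝ) + 1) := Real.sqrt_le_sqrt (by linarith)
    rw [pow_succ, Module.End.mul_apply, generator, LinearMap.sub_apply, creation_single,
      annihilation_single, ← generator, map_sub, map_sub]
    refine (norm_sub_le _ _).trans ((add_le_add h1 h2).trans ?_)
    rw [hs]
    set b := √(((D + 1 + 1).ascFactorial j : ℕ) : ℝ)
    calc ‖a‖ * √((n k : ℝ) + 1) * (2 ^ j * b) + ‖a‖ * √(n k : ℝ) * (2 ^ j * b)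
        ≤ ‖a‖ * √((D : ℝ) + 1) * (2 ^ j * b) + ‖a‖ * √((D : ℝ) + 1) * (2 ^ j * b) := by gcongr
      _ = _ := by ring

theorem summable_two_pow_mul_sqrt_ascFactorial_div (D : ℕ) :
    Summable fun j : ℕ => ((j ! : ℕ) : ℝ)⁻¹ * (2 ^ j * √((D + 1).ascFactorial j : ℝ)) := by
  have hpos (j : ℕ) : 0 < ((j ! : ℕ) : ℝ)⁻¹ * (2 ^ j * √((D + 1).ascFactorial j : ℝ)) := by
    have : 0 < (D + 1).ascFactorial j := Nat.ascFactorial_pos _ _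
    positivity
  refine summable_of_ratio_test_tendsto_lt_one (l := 0) zero_lt_one
    (Filter.Eventually.of_forall fun j => (hpos j).ne') ?_
  have heq (j : ℕ) :
      ‖(((j + 1) ! : ℕ) : ℝ)⁻¹ * (2 ^ (j + 1) * √((D + 1).ascFactorial (j + 1) : ℝ))‖ /
        ‖((j ! : ℕ) : ℝ)⁻¹ * (2 ^ j * √((D + 1).ascFactorial j : ℝ))‖ =
      -- The ratio is 2√(D + 1 + j)/(j + 1), written through 1/(j + 1) so that its limit 0 is
      -- immediate.
      √(4 * (1 / ((j : ℝ) + 1) + D * (1 / ((j : ℝ) + 1)) ^ 2)) := by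
    rw [Real.norm_of_nonneg (hpos _).le, Real.norm_of_nonneg (hpos _).le]
    have hr : √(4 * (1 / ((j : ℝ) + 1) + D * (1 / ((j : ℝ) + 1)) ^ 2)) =
        2 * √((D : ℝ) + 1 + j) / (j + 1) := by
      rw [show 4 * (1 / ((j : ℝ) + 1) + D * (1 / ((j : ℝ) + 1)) ^ 2) =
        (2 / (j + 1)) ^ 2 * ((D : ℝ) + 1 + j) by field_simp; ring,
        Real.sqrt_mul (by positivity), Real.sqrt_sq (by positivity)]
      ring
    have h1 : (0 : ℝ) < √(((D + 1).ascFactorial j : ℕ) : ℝ) :=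
      Real.sqrt_pos.2 (Nat.cast_pos.2 (Nat.ascFactorial_pos _ _))
    rw [hr, Nat.ascFactorial_succ, Nat.factorial_succ]
    push_cast
    rw [Real.sqrt_mul (by positivity), pow_succ]
    field_simp
  simp only [heq]
  have h1 : Filter.Tendsto (fun j : ℕ => 1 / ((j : ℝ) + 1)) Filter.atTop (nhds 0) :=
    tendsto_one_div_add_atTop_nhds_zero_nat
  have h2 := ((h1.add ((h1.pow 2).const_mul (D : ℝ))).const_mul 4).sqrt
  simpa using h2

theorem exists_isDisplacement_one {M : ℕ} (k : Fin M) (ψ : Core M) :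
    ∃ Φ, IsDisplacement k 1 ψ Φ := by
  change Summable _
  have hg : (1 : ℂ) • creation k - (starRingEnd ℂ) 1 • annihilation k = generator k := by
    rw [map_one, one_smul, one_smul, generator]
  rw [hg]
  induction ψ using Finsupp.induction_linear with
  | zero => simp
  | add f g hf hg => simpa only [map_add, smul_add] using hf.add hg
  | single n a =>
    refine Summable.of_norm_bounded
      ((summable_two_pow_mul_sqrt_ascFactorial_div (n k)).mul_left ‖a‖) fun j => ?_
    rw [norm_smul, norm_inv, Complex.norm_natCast, mul_left_comm]
    gcongr
    exact norm_toFock_generator_pow_single_le k j n a _ le_rfl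

/-- Coordinates are continuous on ℓ², so norm convergence identifies each amplitude with the sum of
its scalar series. -/
theorem project_zero_of_isDisplacement {M : ℕ} {ψ : Core (M + 1)} {Φ : Fock (M + 1)}
    (h : IsDisplacement 0 1 ψ Φ) :
    Fock.project 0 Φ = Complex.exp (-1 / 2) • Core.toFock (evalMode ψ) := by
  ext n
  have h1 : HasSum (seriesTerm n ψ) (Φ (Finsupp.cons 0 n)) := by
    have h2 := ContinuousLinearMap.hasSum
      (lp.evalCLM ℂ (fun _ : Fin (M + 1) →₀ ℕ => ℂ) 2 (Finsupp.cons 0 n)) h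
    have hg : (1 : ℂ) • creation (0 : Fin (M + 1)) - (starRingEnd ℂ) 1 • annihilation 0 =
        generator 0 := by
      rw [map_one, one_smul, one_smul, generator]
    rw [hg] at h2
    have heval (F : Fock (M + 1)) : lp.evalCLM ℂ (fun _ : Fin (M + 1) →₀ ℕ => ℂ) 2
        (Finsupp.cons 0 n) F = F (Finsupp.cons 0 n) := rfl
    simp only [heval, lp.coeFn_smul, Pi.smul_apply, toFock_apply] at h2
    exact h2
  rw [lp.coeFn_smul, Pi.smul_apply, toFock_apply, smul_eq_mul]
  exact h1.unique (hasSum_seriesTerm n ψ)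

/-! ### Conditioning in the stellar representation -/

theorem sqrt_factorial_ne_zero (k : ℕ) : ((√(k ! : ℝ) : ℝ) : ℂ) ≠ 0 :=
  Complex.ofReal_ne_zero.2 (Real.sqrt_pos.2 (by positivity)).ne'

theorem sqrt_multiFactorial_eq {m : ℕ} (n : Fin (m + 1) →₀ ℕ) :
    ((√(multiFactorial n : ℝ) : ℝ) : ℂ) =
      ((√((n 0)! : ℝ) : ℝ) : ℂ) * ((√(multiFactorial n.tail : ℝ) : ℝ) : ℂ) := by
  have h : multiFactorial n = (n 0)! * multiFactorial n.tail := by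
    rw [multiFactorial, Fin.prod_univ_succ]
    rfl
  rw [← Complex.ofReal_mul, ← Real.sqrt_mul (by positivity), h, Nat.cast_mul]

theorem stellar_project {m : ℕ} (k : ℕ) (ψ : Core (m + 1)) :
    stellar (Core.project k ψ) = MvPolynomial.C ((√(k ! : ℝ) : ℝ) : ℂ) *
      (MvPolynomial.finSuccEquiv ℂ m (stellar ψ)).coeff k := by
  ext n
  rw [MvPolynomial.coeff_C_mul, MvPolynomial.finSuccEquiv_coeff_coeff, coeff_stellar, coeff_stellar,
    sqrt_multiFactorial_eq (Finsupp.cons k n), Finsupp.cons_zero, Finsupp.tail_cons]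
  have h1 := sqrt_factorial_ne_zero k
  have h2 := sqrt_multiFactorial_ne_zero n
  rw [Core.project, Finsupp.comapDomain_apply]
  field_simp

theorem aeval_cons_monomial {m : ℕ} (t a : ℂ) (k : Fin (m + 1) →₀ ℕ) :
    MvPolynomial.aeval (Fin.cons (MvPolynomial.C t) MvPolynomial.X :
      Fin (m + 1) → MvPolynomial (Fin m) ℂ) (MvPolynomial.monomial k a) =
      MvPolynomial.monomial k.tail (a * t ^ k 0) := by
  rw [MvPolynomial.aeval_monomial, Finsupp.prod_fintype _ _ (fun i => pow_zero _),
    Fin.prod_univ_succ]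
  simp only [Fin.cons_zero, Fin.cons_succ]
  rw [MvPolynomial.algebraMap_eq, MvPolynomial.monomial_eq (s := k.tail),
    Finsupp.prod_fintype _ _ (fun i => pow_zero _), map_mul, map_pow, mul_assoc]
  rfl

theorem stellar_evalMode {M : ℕ} (ψ : Core (M + 1)) :
    stellar (evalMode ψ) = MvPolynomial.aeval (Fin.cons (MvPolynomial.C (-1)) MvPolynomial.X :
      Fin (M + 1) → MvPolynomial (Fin M) ℂ) (stellar ψ) := by
  induction ψ using Finsupp.induction_linear with
  | zero => simp
  | add f g hf hg => rw [map_add, map_add, hf, hg, map_add, map_add]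
  | single k a =>
    rw [evalMode_single, stellar_single, stellar_single, aeval_cons_monomial,
      sqrt_multiFactorial_eq k]
    congr 1
    have h1 := sqrt_factorial_ne_zero (k 0)
    have h2 := sqrt_multiFactorial_ne_zero k.tail
    field_simp

theorem aeval_homogenization {M : ℕ} (d : ℕ) (P : MvPolynomial (Fin M) ℂ) :
    MvPolynomial.aeval (Fin.cons (MvPolynomial.C 1) MvPolynomial.X :
      Fin (M + 1) → MvPolynomial (Fin M) ℂ) (homogenization d P) = P := by
  rw [homogenization, map_sum]
  simp only [aeval_cons_monomial, one_pow, mul_one, Finsupp.tail_cons]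
  exact P.support_sum_monomial_coeff

theorem aeval_linearForm_neg {M : ℕ} (w : Fin (M + 1) → ℂ) :
    MvPolynomial.aeval (Fin.cons (MvPolynomial.C (-1)) MvPolynomial.X :
      Fin (M + 1) → MvPolynomial (Fin M) ℂ)
        (linearForm (Fin.cons (-w 0) fun i => w i.succ : Fin (M + 1) → ℂ)) =
    MvPolynomial.aeval (Fin.cons (MvPolynomial.C 1) MvPolynomial.X :
      Fin (M + 1) → MvPolynomial (Fin M) ℂ) (linearForm w) := by
  simp [linearForm, Fin.sum_univ_succ]

/-! ### Sums of powers as coefficients of products of linear forms -/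

theorem finSuccEquiv_linearForm_cons_one {m : ℕ} (u : Fin m → ℂ) :
    MvPolynomial.finSuccEquiv ℂ m (linearForm (Fin.cons 1 u : Fin (m + 1) → ℂ)) =
      Polynomial.X + Polynomial.C (linearForm u) := by
  have hC (a : ℂ) : MvPolynomial.finSuccEquiv ℂ m (MvPolynomial.C a) =
      Polynomial.C (MvPolynomial.C a) := by
    simp [MvPolynomial.finSuccEquiv_apply]
  simp [linearForm, Fin.sum_univ_succ, MvPolynomial.finSuccEquiv_X_zero,
    MvPolynomial.finSuccEquiv_X_succ, hC]

/-- This is Vieta's formula for the second-highest coefficient of ∏ (X - a_k), transported by `X ↦ X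
^ d`. -/
theorem coeff_prod_X_pow_sub_C {R : Type*} [CommRing R] {d r : ℕ} (hd : 0 < d) (hr : 0 < r)
    (a : Fin r → R) :
    (∏ k, ((Polynomial.X : Polynomial R) ^ d - Polynomial.C (a k))).coeff (d * (r - 1)) =
      -∑ k, a k := by
  have h := Polynomial.prod_X_sub_C_coeff_card_pred univ a (by simpa using hr)
  rw [← Polynomial.coeff_expand_mul' hd, map_prod, Finset.card_univ, Fintype.card_fin] at h
  simpa using h

theorem exists_prod_linearForm_coeff_eq_sum_pow {m d r : ℕ} (hd : 0 < d) (hr : 0 < r)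
    (w : Fin r → Fin m → ℂ) :
    ∃ v : Fin (d * r) → Fin (m + 1) → ℂ, (∀ s, v s ≠ 0) ∧
      (MvPolynomial.finSuccEquiv ℂ m (∏ s, linearForm (v s))).coeff (d * (r - 1)) =
        ∑ k, linearForm (w k) ^ d := by
  obtain ⟨η, hη⟩ := IsAlgClosed.exists_pow_nat_eq (-1 : ℂ) hd
  set ζ : ℂ := Complex.exp (2 * Real.pi * Complex.I / d)
  have hζ : IsPrimitiveRoot ζ d := Complex.isPrimitiveRoot_exp d hd.ne'
  have hζ' : IsPrimitiveRoot (MvPolynomial.C ζ : MvPolynomial (Fin m) ℂ) d :=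
    hζ.map_of_injective (MvPolynomial.C_injective (Fin m) ℂ)
  -- With η^d = -1, the forms λ - ζ^j η ℓ_k over all j multiply to λ^d + ℓ_k^d. The coefficient 1 of
  -- λ makes every form nonzero.
  refine ⟨fun s => Fin.cons 1 (-(ζ ^ (finProdFinEquiv.symm s).1.val * η) •
    w (finProdFinEquiv.symm s).2), fun s h => by simpa using congrFun h 0, ?_⟩
  have hfactor (k : Fin r) :
      ∏ j : Fin d, (Polynomial.X + Polynomial.C (linearForm (-(ζ ^ j.val * η) • w k))) =
        Polynomial.X ^ d - Polynomial.C (-linearForm (w k) ^ d) := by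
    rw [X_pow_sub_C_eq_prod hζ' (α := MvPolynomial.C η * linearForm (w k)) hd
      (by rw [mul_pow, ← map_pow, hη, map_neg, map_one, neg_one_mul]), ← Fin.prod_univ_eq_prod_range
      (fun j => Polynomial.X - Polynomial.C
        (MvPolynomial.C ζ ^ j * (MvPolynomial.C η * linearForm (w k))))]
    refine Finset.prod_congr rfl fun j _ => ?_
    rw [linearForm_smul, sub_eq_add_neg, ← map_neg Polynomial.C]
    congr 2
    rw [map_neg, map_mul, map_pow]
    ring
  rw [map_prod]
  simp only [finSuccEquiv_linearForm_cons_one]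
  rw [finProdFinEquiv.symm.prod_comp fun p : Fin d × Fin r =>
    Polynomial.X + Polynomial.C (linearForm (-(ζ ^ p.1.val * η) • w p.2)), Fintype.prod_prod_type,
    Finset.prod_comm]
  simp only [hfactor]
  rw [coeff_prod_X_pow_sub_C hd hr, Finset.sum_neg_distrib, neg_neg]

theorem exists_additionCircuit_evalMode_eq_smul {M d r : ℕ} {ψ : Core M} (hψ : ψ ≠ 0) (hd : 0 < d)
    (h : HasWaringDecomposition d (homogenization d (stellar ψ)) r) :
    ∃ (U : Fin (d * r) → Matrix.unitaryGroup (Fin (M + 2)) ℂ) (c : ℂ), c ≠ 0 ∧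
      evalMode (Core.project (d * (r - 1)) (additionCircuit U)) = c • ψ := by
  obtain ⟨w, hw⟩ := h
  have heval : ∑ k, MvPolynomial.aeval (Fin.cons (MvPolynomial.C 1) MvPolynomial.X :
      Fin (M + 1) → MvPolynomial (Fin M) ℂ) (linearForm (w k)) ^ d = stellar ψ := by
    rw [← aeval_homogenization d (stellar ψ), hw, map_sum]
    simp only [map_pow]
    rfl
  -- An empty decomposition would force `stellar ψ = 0`.
  have hr : 0 < r := by
    rcases Nat.eq_zero_or_pos r with rfl | hr
    · exact absurd (stellar_injective (by rw [← heval, map_zero]; rfl)) hψ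
    · exact hr
  obtain ⟨v, hv, hcoeff⟩ := exists_prod_linearForm_coeff_eq_sum_pow hd hr
    fun k => (Fin.cons (-w k 0) fun i => w k i.succ : Fin (M + 1) → ℂ)
  obtain ⟨U, c, hc, hU⟩ := exists_additionCircuit_stellar v hv
  refine ⟨U, ((√((d * (r - 1))! : ℝ) : ℝ) : ℂ) * c, mul_ne_zero (sqrt_factorial_ne_zero _) hc,
    stellar_injective ?_⟩
  rw [stellar_evalMode, stellar_project, hU, map_smul, Polynomial.coeff_smul, hcoeff, map_smul,
    ← heval, MvPolynomial.smul_eq_C_mul, MvPolynomial.smul_eq_C_mul, map_mul, map_mul, map_mul,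
    map_sum]
  simp only [map_pow, aeval_linearForm_neg, MvPolynomial.algHom_C, MvPolynomial.algebraMap_eq]
  rw [mul_assoc]

theorem exists_additionCircuit_evalMode_eq_smul_of_degree_zero {M : ℕ} {ψ : Core M} (hψ : ψ ≠ 0)
    (hd : ∀ n ∈ ψ.support, n.degree ≤ 0) (r : ℕ) :
    ∃ (U : Fin (0 * r) → Matrix.unitaryGroup (Fin (M + 2)) ℂ) (c : ℂ), c ≠ 0 ∧
      evalMode (Core.project (0 * (r - 1)) (additionCircuit U)) = c • ψ := by
  have hsupp (n : Fin M →₀ ℕ) (hn : n ≠ 0) : ψ n = 0 := by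
    by_contra h
    exact hn ((Finsupp.degree_eq_zero_iff n).1 (Nat.le_zero.1 (hd n (Finsupp.mem_support_iff.2 h))))
  obtain ⟨a, rfl⟩ : ∃ a : ℂ, ψ = a • vacuum M := by
    refine ⟨ψ 0, ?_⟩
    ext n
    rw [Finsupp.smul_apply, vacuum, Finsupp.single_apply, smul_eq_mul]
    split_ifs with h
    · rw [← h, mul_one]
    · rw [hsupp n (Ne.symm h), mul_zero]
  have ha : a ≠ 0 := fun h => hψ (by rw [h, zero_smul])
  -- There are no rounds: the circuit is the vacuum, of which `ψ` is a multiple. `0 * r` does not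
  -- reduce to `0` definitionally for a variable `r`.
  have : IsEmpty (Fin (0 * r)) := by rw [Nat.zero_mul]; infer_instance
  obtain ⟨U, c, hc, hU⟩ := exists_additionCircuit_stellar (m := M + 1) (N := 0 * r)
    isEmptyElim fun s => isEmptyElim s
  rw [Fintype.prod_empty] at hU
  refine ⟨U, c * a⁻¹, mul_ne_zero hc (inv_ne_zero ha), stellar_injective ?_⟩
  rw [smul_smul, inv_mul_cancel_right₀ ha, stellar_evalMode, stellar_project, hU, map_smul, map_smul,
    stellar_vacuum, Nat.zero_mul, map_one, Polynomial.coeff_smul, Polynomial.coeff_one_zero]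
  simp [map_smul]

end Bosonic

end

open Bosonic
theorem theorem1 (M d : ℕ) (ψ : Core M) (hψ : ψ ≠ 0)
    (hd : ∀ n ∈ ψ.support, n.degree ≤ d) (r : ℕ)
    (hr : r = waringRank d (homogenization d (stellarPolynomial ψ))) :
    (0 < d → HasWaringDecomposition d (homogenization d (stellarPolynomial ψ)) r) ∧
    ∃ (U : Fin (d * r) → Matrix.unitaryGroup (Fin (M + 2)) ℂ) (Φ : Fock (M + 1)) (c : ℂ),
      IsDisplacement 0 1 (Core.project (d * (r - 1)) (additionCircuit U)) Φ ∧
      c ≠ 0 ∧ Fock.project 0 Φ = c • Core.toFock ψ := by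
  have hwaring : 0 < d → HasWaringDecomposition d (homogenization d (stellarPolynomial ψ)) r := by
    intro hd0
    rw [hr]
    -- The infimum is attained once some decomposition exists; for an empty set `sInf` would be the
    -- default 0.
    refine Nat.sInf_mem (exists_hasWaringDecomposition_homogenization hd0 _ fun n hn => hd n ?_)
    rw [MvPolynomial.mem_support_iff, stellarPolynomial_eq_stellar, coeff_stellar] at hn
    exact Finsupp.mem_support_iff.2 fun h => hn (by rw [h, zero_div])
  refine ⟨hwaring, ?_⟩
  obtain ⟨U, c, hc, hU⟩ : ∃ (U : Fin (d * r) → Matrix.unitaryGroup (Fin (M + 2)) ℂ) (c : ℂ),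
      c ≠ 0 ∧ evalMode (Core.project (d * (r - 1)) (additionCircuit U)) = c • ψ := by
    rcases Nat.eq_zero_or_pos d with rfl | hd0
    · exact exists_additionCircuit_evalMode_eq_smul_of_degree_zero hψ hd r
    · exact exists_additionCircuit_evalMode_eq_smul hψ hd0
        (by simpa only [stellarPolynomial_eq_stellar] using hwaring hd0)
  obtain ⟨Φ, hΦ⟩ := exists_isDisplacement_one 0
    (Core.project (d * (r - 1)) (additionCircuit U))
  refine ⟨U, Φ, Complex.exp (-1 / 2) * c, hΦ, mul_ne_zero (Complex.exp_ne_zero _) hc, ?_⟩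
  rw [project_zero_of_isDisplacement hΦ, hU, map_smul, smul_smul]
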